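/- Let $d\ge 1$ and $N\ge 1$ be integers, write $Y,Z$ for the Pauli matrices, and for $x\in[0,1]^d$ let $$\mathcal V_N(x)=V_1(x)\otimes\cdots\otimes V_N(x),\qquad V_j(x)=e^{-i\arccos(\sqrt{x_{[j]}})\,Y},$$ where $[j]\in\{1,\dots,d\}$ and $[j]\equiv j \pmod d$. For an observable $O$ on $N$ qubits put $\psi_O(x)=\langle 0|^{\otimes N}\mathcal V_N(x)^\dagger\, O\,\mathcal V_N(x)|0\rangle^{\otimes N}$. An *output function of the $N$-qubit parallel model* is a function $f=\sum_{\alpha\in\{0,1\}^N} w_\alpha\psi_{O_\alpha}$ on $[0,1]^d$ with real weights $w_\alpha$, where $O_\alpha=Z^{\alpha_1}\otimes\cdots\otimes Z^{\alpha_N}$; if $N=nd$, it is moreover required to be of the form $f=\sum_{p\in\{0,\dots,n\}^d}w_p\psi_{O_p}$ with real weights $w_p$, where $O_p=A_1\otimes\cdots\otimes A_N$ and, for $1\le i\le d$ and $0\le k<n$, $A_{i+kd}=(I+Z)/2$ if $k<p_i$ and $A_{i+kd}=(I-Z)/2$ if $k\ge p_i$. For a set $X\subseteq[0,1]^d$ and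 $g:X\to\mathbb R$ let $\omega(\delta)=\sup\{|g(x)-g(y)| : x,y\in X,\ \|x-y\|_2\le\delta\}$. **Theorem.** There is an absolute constant $A>0$ (independent of $d$, $N$, $X$, $g$) such that for every $d\ge1$, every compact $X\subseteq[0,1]^d$ and every continuous $g:X\to\mathbb R$ the following hold. 1. Suppose that $X$ is convex (for instance $X=[0,1]^d$). Then for every $N\ge1$ there is an output function $f$ of the $N$-qubit parallel model with $$|g(x)-f(x)|\le A\,\omega\!\left(\frac{d^{3/2}}{N}\right)\qquad\text{for all }x\in X,$$ and the inequality is strict for all $x\in X$ if $g$ is not constant. Consequently, for every $\varepsilon>0$, the inequality $A\,\omega(d^{3/2}/N)<\varepsilon$ holds for all sufficiently large $N$, and for each $N\ge1$ for which it holds there is an output function $f$ of the $N$-qubit parallel model with $|g(x)-f(x)|<\varepsilon$ for all $x\in X$. 2. Suppose that $g$ is Lipschitz on $X$ with constant $C\ge0$ with respect to the Euclidean norm ($X$ need not be convex). Then for every $N\ge1$ there is an output function $f$ of the $N$-qubit parallel model with $|g(x)-f(x)|\le A\,C\,d^{3/2}N^{-1}$ for all $x\in X$; and for every $\varepsilon>0$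 and every integer $N\geq 1$ with $N>A\,C\,d^{3/2}\varepsilon^{-1}$ there is such an $f$ with $|g(x)-f(x)|<\varepsilon$ for all $x\in X$. That is, $N=O(d^{3/2}\varepsilon^{-1})$ qubits suffice, with error $O(d^{3/2}N^{-1})$. -/

import Mathlib

open scoped Matrix

noncomputable section

namespace QuantumFeature

/-- The input cube `[0,1]^d` in Euclidean space. -/
def unitCube (d : ℕ) : Set (EuclideanSpace ℝ (Fin d)) :=
  {x | ∀ i, x i ∈ Set.Icc (0 : ℝ) 1}

/-- The modulus of continuity `ω(δ) = sup {|g x - g y| : x, y ∈ X, ‖x - y‖₂ ≤ δ}` of `g` on `X`. -/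
def modulus {d : ℕ} (X : Set (EuclideanSpace ℝ (Fin d))) (g : EuclideanSpace ℝ (Fin d) → ℝ)
    (δ : ℝ) : ℝ :=
  sSup {r | ∃ x ∈ X, ∃ y ∈ X, ‖x - y‖ ≤ δ ∧ r = |g x - g y|}

/-- Operators on one qubit. -/
abbrev QubitOp : Type := Matrix (Fin 2) (Fin 2) ℂ

/-- Operators on `N` qubits, in the computational basis indexed by bit strings. -/
abbrev RegisterOp (N : ℕ) : Type := Matrix (Fin N → Fin 2) (Fin N → Fin 2) ℂ

/-- Pauli `Y`. -/
def pauliY : QubitOp := !![0, -Complex.I; Complex.I, 0]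

/-- Pauli `Z`. -/
def pauliZ : QubitOp := !![1, 0; 0, -1]

/-- The tensor (Kronecker) product `A₁ ⊗ A₂ ⊗ ⋯ ⊗ A_N` of one-qubit operators. -/
def tensor {N : ℕ} (A : Fin N → QubitOp) : RegisterOp N :=
  Matrix.of fun s t => ∏ j, A j (s j) (t j)

/-- The state `|0⟩^{⊗ N}`. -/
def ketZero (N : ℕ) : (Fin N → Fin 2) → ℂ := Pi.single (fun _ => 0) 1

/-- The rotation `V(t) = exp(-i arccos(√t) Y)` encoding one input coordinate `t`. -/
def encodeQubit (t : ℝ) : QubitOp :=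
  NormedSpace.exp ((-Complex.I * (Real.arccos (Real.sqrt t) : ℂ)) • pauliY)

/-- The parallel circuit `𝒱_N(x) = V₁(x) ⊗ ⋯ ⊗ V_N(x)`. The qubits and the coordinates are
numbered from `0`, so that qubit `j` encodes the coordinate `j mod d`. -/
def circuit {d : ℕ} [NeZero d] (N : ℕ) (x : EuclideanSpace ℝ (Fin d)) : RegisterOp N :=
  tensor fun j => encodeQubit (x (Fin.ofNat d j))

/-- The basis function `ψ_O(x) = ⟨0|^{⊗ N} 𝒱_N(x)† O 𝒱_N(x) |0⟩^{⊗ N}` of an observable `O`. -/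
def basisFunction {d : ℕ} [NeZero d] {N : ℕ} (O : RegisterOp N)
    (x : EuclideanSpace ℝ (Fin d)) : ℂ :=
  star (ketZero N) ⬝ᵥ (((circuit N x)ᴴ * O * circuit N x) *ᵥ ketZero N)

/-- `f` is the output function `∑ w_i ψ_{O_i}` of the `N`-qubit circuit measured in the finite
family of observables `O`, for some real weights `w`. -/
def IsOutput {d : ℕ} [NeZero d] {N : ℕ} {ι : Type} [Fintype ι] (O : ι → RegisterOp N)
    (f : EuclideanSpace ℝ (Fin d) → ℝ) : Prop :=
  ∃ w : ι → ℝ, ∀ x ∈ unitCube d, (f x : ℂ) = ∑ i, (w i : ℂ) * basisFunction (O i) x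

/-- The observables `O_α = Z^{α₁} ⊗ ⋯ ⊗ Z^{α_N}`, `α ∈ {0,1}^N`. -/
def pauliObservable (N : ℕ) (α : Fin N → Fin 2) : RegisterOp N :=
  tensor fun j => pauliZ ^ (α j : ℕ)

/-- The observables `O_p = A₁ ⊗ ⋯ ⊗ A_N`, `p ∈ {0,…,n}^d`, where `n = N / d`; the factor at the
qubit `j = i + k d` is `(I + Z)/2` for `k < p_i` and `(I - Z)/2` for `k ≥ p_i`. -/
def projectorObservable (d : ℕ) [NeZero d] (N : ℕ) (p : Fin d → Fin (N / d + 1)) :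
    RegisterOp N :=
  tensor fun j =>
    if (j : ℕ) / d < (p (Fin.ofNat d j) : ℕ) then (1 / 2 : ℂ) • (1 + pauliZ)
    else (1 / 2 : ℂ) • (1 - pauliZ)

/-- `f` is an output function of the `N`-qubit parallel model: a real combination of the basis
functions of the observables `O_α`, and, if `N` is a multiple of `d`, also of those of the
observables `O_p`. -/
def IsParallelOutput {d : ℕ} [NeZero d] (N : ℕ) (f : EuclideanSpace ℝ (Fin d) → ℝ) : Prop :=
  IsOutput (pauliObservable N) f ∧ (d ∣ N → IsOutput (projectorObservable d N) f)

end QuantumFeature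

end

noncomputable section

namespace QuantumFeature

/-! ### The basis functions of tensor observables -/

/-! Circuit and observables are tensor products, so each basis function is a product over qubits. A
qubit encoding `t` is in the state `√t |0⟩ + √(1-t) |1⟩`, in which `diag(a, b)` has expectation `t a
+ (1-t) b`. Every coordinate is encoded by at least `n = N / d` qubits. Hence both families of
observables produce every product of one-variable polynomials of degree at most `n`: powers of `2
x_i - 1` from the `O_α`, the Bernstein basis from the `O_p` (`isParallelOutput_prod`).

What remains is a Jackson theorem with explicit dependence on `d`. `exists_jackson_partition` gives
nonnegative polynomials `q_k` of degree at most `n` with sum `1` on `[0,1]` and mean square distance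
to nodes `t_k` at most `5 / (n+2)²`. They come from the Fejér–Korovkin kernel, sampled at equally
spaced angles and made even in the angle. Tensor products of the `q_k` give weights on a grid in
`ℝ^d` with mean square distance at most `5 d / (n+2)²`; taking the square root yields the scale `√d
/ (n+2) ≤ d^{3/2} / N`.

The approximant averages with these weights the values of `g` at points of `X` nearest to the grid
points, so `g` need not be extended beyond `X`. A bound `|g x - g y| ≤ a + b ‖x - y‖` then suffices.
The Lipschitz case has `a = 0`; on convex `X`, subdividing segments gives `a = ω(δ)` and `b = ω(δ) /
δ`. -/

theorem tensor_conjTranspose {N : ℕ} (A : Fin N → QubitOp) :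
    (tensor A)ᴴ = tensor fun j => (A j)ᴴ := by
  ext s t
  simp [tensor, Matrix.conjTranspose_apply]

theorem tensor_mul {N : ℕ} (A B : Fin N → QubitOp) :
    tensor A * tensor B = tensor fun j => A j * B j := by
  ext s t
  simp only [tensor, Matrix.mul_apply, Matrix.of_apply, ← Finset.prod_mul_distrib]
  exact (Fintype.prod_sum fun j u => A j (s j) u * B j u (t j)).symm

theorem basisFunction_eq {d : ℕ} [NeZero d] {N : ℕ} (O : RegisterOp N)
    (x : EuclideanSpace ℝ (Fin d)) :
    basisFunction O x =
      ((circuit N x)ᴴ * O * circuit N x) (fun _ => 0) (fun _ => 0) := by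
  simp only [basisFunction, ketZero, Matrix.mulVec_single_one]
  rw [← Pi.single_star, star_one, single_one_dotProduct]
  rfl

theorem basisFunction_tensor {d : ℕ} [NeZero d] {N : ℕ} (A : Fin N → QubitOp)
    (x : EuclideanSpace ℝ (Fin d)) :
    basisFunction (tensor A) x =
      ∏ j : Fin N, ((encodeQubit (x (Fin.ofNat d j)))ᴴ * A j *
        encodeQubit (x (Fin.ofNat d j))) 0 0 := by
  rw [basisFunction_eq, circuit, tensor_conjTranspose, tensor_mul, tensor_mul]
  rfl

/-- Diagonalise `Y`: the columns of `U` are its eigenvectors `(1, i)` and `(1, -i)`, with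
eigenvalues `1` and `-1`. -/
theorem exp_smul_pauliY (θ : ℝ) :
    NormedSpace.exp ((-Complex.I * (θ : ℂ)) • pauliY) =
      !![(Real.cos θ : ℂ), -(Real.sin θ : ℂ); (Real.sin θ : ℂ), (Real.cos θ : ℂ)] := by
  set U : QubitOp := !![1, 1; Complex.I, -Complex.I] with hU
  set W : QubitOp := !![1 / 2, -Complex.I / 2; 1 / 2, Complex.I / 2] with hW
  have hUW : U * W = 1 := by
    ext i j
    fin_cases i <;> fin_cases j <;> simp [hU, hW, Matrix.mul_apply, Fin.sum_univ_two] <;> ring_nf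
    all_goals simp
  have hinv : U⁻¹ = W := Matrix.inv_eq_right_inv hUW
  have hunit : IsUnit U :=
    (Matrix.isUnit_iff_isUnit_det U).2 (Matrix.isUnit_det_of_right_inverse hUW)
  have hD : ∀ a b : ℂ, Matrix.diagonal ![a, b] = !![a, 0; 0, b] := by
    intro a b
    ext i j
    fin_cases i <;> fin_cases j <;> simp
  have hdiag : (-Complex.I * (θ : ℂ)) • pauliY =
      U * Matrix.diagonal ![-(θ * Complex.I), θ * Complex.I] * U⁻¹ := by
    rw [hinv, hD]
    ext i j
    fin_cases i <;> fin_cases j <;>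
      simp [hU, hW, pauliY, Matrix.mul_apply, Fin.sum_univ_two] <;> ring_nf
  rw [hdiag, Matrix.exp_conj _ _ hunit, Matrix.exp_diagonal, hinv]
  have hexp : NormedSpace.exp ![-(θ * Complex.I), θ * Complex.I] =
      ![Complex.cos θ - Complex.sin θ * Complex.I, Complex.cos θ + Complex.sin θ * Complex.I] := by
    ext i
    rw [Pi.coe_exp]
    fin_cases i
    · simp [← Complex.exp_eq_exp_ℂ, ← neg_mul, Complex.exp_mul_I, sub_eq_add_neg]
    · simp [← Complex.exp_eq_exp_ℂ, Complex.exp_mul_I]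
  rw [hexp, hD]
  ext i j
  fin_cases i <;> fin_cases j <;>
    simp [hU, hW, Matrix.mul_apply, Fin.sum_univ_two] <;> ring_nf <;> simp

theorem encodeQubit_eq {t : ℝ} (ht : t ∈ Set.Icc (0 : ℝ) 1) :
    encodeQubit t = !![(Real.sqrt t : ℂ), -(Real.sqrt (1 - t) : ℂ);
      (Real.sqrt (1 - t) : ℂ), (Real.sqrt t : ℂ)] := by
  rw [encodeQubit, exp_smul_pauliY, Real.cos_arccos, Real.sin_arccos, Real.sq_sqrt ht.1]
  · linarith [Real.sqrt_nonneg t]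
  · exact Real.sqrt_le_one.2 ht.2

theorem encodeQubit_expectation {t : ℝ} (ht : t ∈ Set.Icc (0 : ℝ) 1) (a b : ℂ) :
    ((encodeQubit t)ᴴ * !![a, 0; 0, b] * encodeQubit t) 0 0 = t * a + (1 - t) * b := by
  have h1 : (Real.sqrt t : ℂ) * Real.sqrt t = t := by
    rw [← Complex.ofReal_mul, Real.mul_self_sqrt ht.1]
  have h2 : (Real.sqrt (1 - t) : ℂ) * Real.sqrt (1 - t) = 1 - t := by
    rw [← Complex.ofReal_mul, Real.mul_self_sqrt (sub_nonneg.2 ht.2)]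
    push_cast
    rfl
  rw [encodeQubit_eq ht]
  simp only [Matrix.mul_apply, Fin.sum_univ_two, Matrix.conjTranspose_apply]
  simp
  linear_combination a * h1 + b * h2

theorem basisFunction_pauliObservable {d : ℕ} [NeZero d] {N : ℕ} (α : Fin N → Fin 2)
    {x : EuclideanSpace ℝ (Fin d)} (hx : x ∈ unitCube d) :
    basisFunction (pauliObservable N α) x =
      ((∏ j : Fin N, (2 * x (Fin.ofNat d j) - 1) ^ (α j : ℕ) : ℝ) : ℂ) := by
  rw [pauliObservable, basisFunction_tensor, Complex.ofReal_prod]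
  refine Finset.prod_congr rfl fun j _ => ?_
  have key : ∀ a : Fin 2, pauliZ ^ (a : ℕ) = !![1, 0; 0, (-1) ^ (a : ℕ)] := by
    intro a
    fin_cases a
    · simp [Matrix.one_fin_two]
    · simp [pauliZ]
  rw [key, encodeQubit_expectation (hx _)]
  generalize α j = a
  fin_cases a <;> simp
  ring

theorem basisFunction_projectorObservable {d : ℕ} [NeZero d] {N : ℕ}
    (p : Fin d → Fin (N / d + 1)) {x : EuclideanSpace ℝ (Fin d)} (hx : x ∈ unitCube d) :
    basisFunction (projectorObservable d N p) x =
      ((∏ j : Fin N, if (j : ℕ) / d < (p (Fin.ofNat d j) : ℕ) then x (Fin.ofNat d j)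
        else 1 - x (Fin.ofNat d j) : ℝ) : ℂ) := by
  rw [projectorObservable, basisFunction_tensor, Complex.ofReal_prod]
  refine Finset.prod_congr rfl fun j _ => ?_
  split_ifs
  · have : (1 / 2 : ℂ) • (1 + pauliZ) = !![1, 0; 0, 0] := by
      rw [Matrix.one_fin_two, pauliZ]; norm_num
    rw [this, encodeQubit_expectation (hx _)]
    simp
  · have : (1 / 2 : ℂ) • (1 - pauliZ) = !![0, 0; 0, 1] := by
      ext i j
      fin_cases i <;> fin_cases j <;> norm_num [pauliZ]
    rw [this, encodeQubit_expectation (hx _)]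
    simp

/-! ### Products over the qubits that encode a given coordinate -/

/-- Division with remainder, `j = i + k d`, groups the qubits by the coordinate they encode. If `d`
does not divide `N`, some coordinates have one qubit more, hence the filter. -/
theorem prod_qubits_eq {d N : ℕ} [NeZero d] (F : Fin d → ℕ → ℝ) :
    ∏ j : Fin N, F (Fin.ofNat d j) ((j : ℕ) / d) =
      ∏ i : Fin d, ∏ k ∈ (Finset.range N).filter fun k => (i : ℕ) + k * d < N, F i k := by
  have hd : 0 < d := NeZero.pos d
  rw [Finset.prod_sigma']
  refine Finset.prod_bij' (fun j _ => ⟨Fin.ofNat d j, (j : ℕ) / d⟩)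
    (fun q hq => ⟨(q.1 : ℕ) + q.2 * d, (Finset.mem_filter.1 (Finset.mem_sigma.1 hq).2).2⟩)
    ?_ ?_ ?_ ?_ ?_
  · intro j _
    simp only [Finset.mem_sigma, Finset.mem_univ, true_and, Finset.mem_filter, Finset.mem_range,
      Fin.val_ofNat]
    have := Nat.mod_add_div' (j : ℕ) d
    exact ⟨(Nat.div_le_self _ _).trans_lt j.2, by omega⟩
  · intro q _; exact Finset.mem_univ _
  · intro j _
    ext
    simpa using Nat.mod_add_div' (j : ℕ) d
  · rintro ⟨i, k⟩ _
    have h1 : ((i : ℕ) + k * d) % d = i := by simp [Nat.mod_eq_of_lt i.2]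
    have h2 : ((i : ℕ) + k * d) / d = k := by
      rw [Nat.add_mul_div_right _ _ hd, Nat.div_eq_of_lt i.2, zero_add]
    have h3 : Fin.ofNat d ((i : ℕ) + k * d) = i := Fin.ext (by simpa using h1)
    simp only [h2, h3]
  · intro j _; rfl

theorem add_mul_lt_of_lt_div {d N i k : ℕ} (hi : i < d) (hk : k < N / d) : i + k * d < N := by
  have h1 : (k + 1) * d ≤ N / d * d := Nat.mul_le_mul_right d hk
  have h2 := Nat.div_mul_le_self N d
  rw [add_mul] at h1
  omega

theorem prod_qubits_pow {d N : ℕ} [NeZero d] (m : Fin d → ℕ) (hm : ∀ i, m i ≤ N / d)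
    (y : Fin d → ℝ) :
    ∏ j : Fin N, (if (j : ℕ) / d < m (Fin.ofNat d j) then y (Fin.ofNat d j) else 1) =
      ∏ i, y i ^ m i := by
  rw [prod_qubits_eq fun i k => if k < m i then y i else 1]
  refine Finset.prod_congr rfl fun i _ => ?_
  rw [Finset.prod_ite, Finset.prod_const_one, mul_one, Finset.prod_const, Finset.filter_filter]
  have : (Finset.range N).filter (fun k => (i : ℕ) + k * d < N ∧ k < m i) =
      Finset.range (m i) := by
    ext k
    simp only [Finset.mem_filter, Finset.mem_range]
    refine ⟨fun h => h.2.2, fun h => ?_⟩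
    have hk : k < N / d := h.trans_le (hm i)
    exact ⟨hk.trans_le (Nat.div_le_self _ _), add_mul_lt_of_lt_div i.2 hk, h⟩
  rw [this, Finset.card_range]

/-- Divisibility is essential here: a surplus qubit would contribute an extra factor `z i`, whereas
in `prod_qubits_pow` it contributes only `1`. -/
theorem prod_qubits_ite {d N : ℕ} [NeZero d] (hN : d ∣ N) (m : Fin d → ℕ)
    (hm : ∀ i, m i ≤ N / d) (y z : Fin d → ℝ) :
    ∏ j : Fin N, (if (j : ℕ) / d < m (Fin.ofNat d j) then y (Fin.ofNat d j)
        else z (Fin.ofNat d j)) = ∏ i, y i ^ m i * z i ^ (N / d - m i) := by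
  have hd : 0 < d := NeZero.pos d
  rw [prod_qubits_eq fun i k => if k < m i then y i else z i]
  refine Finset.prod_congr rfl fun i _ => ?_
  have hr : (Finset.range N).filter (fun k => (i : ℕ) + k * d < N) = Finset.range (N / d) := by
    ext k
    simp only [Finset.mem_filter, Finset.mem_range]
    refine ⟨fun h => ?_, fun hk =>
      ⟨hk.trans_le (Nat.div_le_self _ _), add_mul_lt_of_lt_div i.2 hk⟩⟩
    rw [Nat.lt_div_iff_mul_lt_of_dvd hd.ne' hN]
    omega
  rw [hr, Finset.prod_ite, Finset.prod_const, Finset.prod_const]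
  have h1 : (Finset.range (N / d)).filter (fun k => k < m i) = Finset.range (m i) := by
    ext k
    have := hm i
    simp only [Finset.mem_filter, Finset.mem_range]
    omega
  have h2 : (Finset.range (N / d)).filter (fun k => ¬ k < m i) = Finset.Ico (m i) (N / d) := by
    ext k
    simp only [Finset.mem_filter, Finset.mem_range, Finset.mem_Ico]
    omega
  rw [h1, h2, Finset.card_range, Nat.card_Ico]

/-! ### Polynomials as output functions -/

section IsOutput

variable {d : ℕ} [NeZero d] {N : ℕ} {ι : Type} [Fintype ι] {O : ι → RegisterOp N}

theorem IsOutput.of_eq_basisFunction {f : EuclideanSpace ℝ (Fin d) → ℝ} (i : ι)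
    (h : ∀ x ∈ unitCube d, basisFunction (O i) x = (f x : ℂ)) : IsOutput O f := by
  classical
  refine ⟨Pi.single i 1, fun x hx => ?_⟩
  rw [Finset.sum_eq_single i]
  · simp [h x hx]
  · intro j _ hj
    simp [hj]
  · simp

theorem IsOutput.sum {κ : Type*} (s : Finset κ) (c : κ → ℝ)
    {F : κ → EuclideanSpace ℝ (Fin d) → ℝ} (hF : ∀ k, IsOutput O (F k)) :
    IsOutput O fun x => ∑ k ∈ s, c k * F k x := by
  choose w hw using hF
  refine ⟨fun i => ∑ k ∈ s, c k * w k i, fun x hx => ?_⟩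
  push_cast
  simp only [hw _ x hx, Finset.mul_sum, Finset.sum_mul, mul_assoc]
  exact Finset.sum_comm

theorem IsOutput.congr {f g : EuclideanSpace ℝ (Fin d) → ℝ} (hf : IsOutput O f)
    (h : ∀ x ∈ unitCube d, g x = f x) : IsOutput O g := by
  obtain ⟨w, hw⟩ := hf
  exact ⟨w, fun x hx => by rw [h x hx, hw x hx]⟩

/-- Expanding the product of the sums leaves a linear combination of products of basis elements. -/
theorem IsOutput.prod_of_span {n : ℕ} {b : Fin (n + 1) → ℝ → ℝ}
    (hb : ∀ m : Fin d → Fin (n + 1),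
      IsOutput O fun x : EuclideanSpace ℝ (Fin d) => ∏ i, b (m i) (x i))
    {P : Fin d → ℝ → ℝ} (hP : ∀ i, ∃ c : Fin (n + 1) → ℝ, ∀ t, P i t = ∑ m, c m * b m t) :
    IsOutput O fun x : EuclideanSpace ℝ (Fin d) => ∏ i, P i (x i) := by
  choose c hc using hP
  refine (IsOutput.sum Finset.univ (fun m : Fin d → Fin (n + 1) => ∏ i, c i (m i)) hb).congr
    fun x _ => ?_
  simp only [hc, Fintype.prod_sum, Finset.prod_mul_distrib]

end IsOutput

theorem isOutput_pauliObservable_prod_pow {d : ℕ} [NeZero d] {N : ℕ}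
    (m : Fin d → Fin (N / d + 1)) :
    IsOutput (pauliObservable N)
      fun x : EuclideanSpace ℝ (Fin d) => ∏ i, (2 * x i - 1) ^ (m i : ℕ) := by
  refine IsOutput.of_eq_basisFunction
    (fun j => if (j : ℕ) / d < m (Fin.ofNat d j) then 1 else 0) fun x hx => ?_
  rw [basisFunction_pauliObservable _ hx,
    ← prod_qubits_pow (fun i => (m i : ℕ)) (fun i => Nat.lt_succ_iff.1 (m i).2)]
  congr 1
  refine Finset.prod_congr rfl fun j _ => ?_
  split_ifs <;> simp

theorem isOutput_projectorObservable_prod {d : ℕ} [NeZero d] {N : ℕ} (hN : d ∣ N)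
    (m : Fin d → Fin (N / d + 1)) :
    IsOutput (projectorObservable d N)
      fun x : EuclideanSpace ℝ (Fin d) =>
        ∏ i, (x i ^ (m i : ℕ) * (1 - x i) ^ (N / d - (m i : ℕ))) := by
  refine IsOutput.of_eq_basisFunction m fun x hx => ?_
  rw [basisFunction_projectorObservable _ hx,
    ← prod_qubits_ite hN (fun i => (m i : ℕ)) (fun i => Nat.lt_succ_iff.1 (m i).2)]

/-- Degree elevation: `t^m (1-t)^l = t^(m+1) (1-t)^l + t^m (1-t)^(l+1)`. Induction on the missing
degree `k = n - m - l` puts every monomial of degree at most `n` in the Bernstein span. -/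
theorem exists_eval_eq_sum_bernstein {n : ℕ} (P : Polynomial ℝ) (hP : P.natDegree ≤ n) :
    ∃ c : Fin (n + 1) → ℝ, ∀ t,
      P.eval (2 * t - 1) = ∑ m : Fin (n + 1), c m * (t ^ (m : ℕ) * (1 - t) ^ (n - (m : ℕ))) := by
  let S : Submodule ℝ (ℝ → ℝ) := Submodule.span ℝ
    (Set.range fun (m : Fin (n + 1)) t => t ^ (m : ℕ) * (1 - t) ^ (n - (m : ℕ)))
  have hS : ∀ k m l : ℕ, m + l + k = n → (fun t : ℝ => t ^ m * (1 - t) ^ l) ∈ S := by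
    intro k
    induction k with
    | zero =>
      intro m l h
      refine Submodule.subset_span ⟨⟨m, by omega⟩, ?_⟩
      have : n - m = l := by omega
      simp [this]
    | succ k ih =>
      intro m l h
      have := S.add_mem (ih (m + 1) l (by omega)) (ih m (l + 1) (by omega))
      convert this using 1
      ext t
      simp only [Pi.add_apply]
      ring
  have hmem : (fun t : ℝ => P.eval (2 * t - 1)) ∈ S := by
    have hQ : (P.comp (2 * Polynomial.X - 1)).natDegree ≤ n := by
      have h1 : (2 * Polynomial.X - 1 : Polynomial ℝ).natDegree ≤ 1 := by
        compute_degree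
      calc _ ≤ P.natDegree * (2 * Polynomial.X - 1 : Polynomial ℝ).natDegree :=
            Polynomial.natDegree_comp_le
        _ ≤ n * 1 := Nat.mul_le_mul hP h1
        _ = n := mul_one n
    have : (fun t : ℝ => P.eval (2 * t - 1)) = ∑ m ∈ Finset.range (n + 1),
        (P.comp (2 * Polynomial.X - 1)).coeff m • fun t : ℝ => t ^ m * (1 - t) ^ 0 := by
      ext t
      have h := Polynomial.eval_eq_sum_range' (Nat.lt_succ_of_le hQ) t
      simp only [Polynomial.eval_comp] at h
      simpa using h
    rw [this]
    refine S.sum_mem fun m hm => S.smul_mem _ (hS (n - m) m 0 ?_)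
    have := Finset.mem_range.1 hm
    omega
  obtain ⟨c, hc⟩ := (Submodule.mem_span_range_iff_exists_fun ℝ).1 hmem
  refine ⟨c, fun t => ?_⟩
  simpa using (congrFun hc t).symm

theorem isParallelOutput_prod {d : ℕ} [NeZero d] {N : ℕ} (P : Fin d → Polynomial ℝ)
    (hP : ∀ i, (P i).natDegree ≤ N / d) :
    IsParallelOutput N
      fun x : EuclideanSpace ℝ (Fin d) => ∏ i, (P i).eval (2 * x i - 1) := by
  refine ⟨?_, fun hN => ?_⟩
  · refine IsOutput.prod_of_span (b := fun m t => (2 * t - 1) ^ (m : ℕ))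
      (P := fun i t => (P i).eval (2 * t - 1)) isOutput_pauliObservable_prod_pow fun i =>
        ⟨fun m => (P i).coeff m, fun t => ?_⟩
    rw [Polynomial.eval_eq_sum_range' (Nat.lt_succ_of_le (hP i)), Finset.sum_range]
  · exact IsOutput.prod_of_span
      (b := fun m t => t ^ (m : ℕ) * (1 - t) ^ (N / d - (m : ℕ)))
      (P := fun i t => (P i).eval (2 * t - 1)) (isOutput_projectorObservable_prod hN) fun i =>
        exists_eval_eq_sum_bernstein (P i) (hP i)

theorem IsParallelOutput.sum {d : ℕ} [NeZero d] {N : ℕ} {κ : Type*} (s : Finset κ) (c : κ → ℝ)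
    {F : κ → EuclideanSpace ℝ (Fin d) → ℝ} (hF : ∀ k, IsParallelOutput N (F k)) :
    IsParallelOutput N fun x => ∑ k ∈ s, c k * F k x :=
  ⟨IsOutput.sum s c fun k => (hF k).1, fun hN => IsOutput.sum s c fun k => (hF k).2 hN⟩

/-! ### A discrete Jackson kernel -/

/-- The sum is the real part of a multiple of `∑ ζ^k` with `ζ = exp(-2πi m / M)`, an `M`-th root of
unity different from `1` because `M` does not divide `m`. -/
theorem sum_range_cos_eq_zero {M : ℕ} {m : ℤ} (hm : m ≠ 0) (hmM : |m| < M) (θ : ℝ) :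
    ∑ k ∈ Finset.range M, Real.cos (m * (θ - 2 * Real.pi * k / M)) = 0 := by
  have hM : (M : ℝ) ≠ 0 := by
    rintro h
    rw [Nat.cast_eq_zero.1 h] at hmM
    exact absurd hmM (not_lt.2 (abs_nonneg m))
  have hMC : (M : ℂ) ≠ 0 := by exact_mod_cast hM
  set ζ : ℂ := Complex.exp (-(m * (2 * Real.pi * Complex.I) / M)) with hζ
  have hpow : ζ ^ M = 1 := by
    rw [hζ, ← Complex.exp_nat_mul, Complex.exp_eq_one_iff]
    refine ⟨-m, ?_⟩
    push_cast
    field_simp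
  have hne : ζ ≠ 1 := by
    intro h
    obtain ⟨r, hr⟩ := Complex.exp_eq_one_iff.1 h
    have h2 : (2 * Real.pi * Complex.I : ℂ) ≠ 0 := Complex.two_pi_I_ne_zero
    have h3 : (-(m : ℂ)) = r * M := by
      have : (2 * Real.pi * Complex.I : ℂ) * (-(m : ℂ)) = 2 * Real.pi * Complex.I * (r * M) := by
        field_simp at hr
        linear_combination (2 * Real.pi * Complex.I) * hr
      exact mul_left_cancel₀ h2 this
    have h4 : -m = r * M := by exact_mod_cast h3
    have h5 : (M : ℤ) ∣ m := (Int.dvd_neg).1 ⟨r, by rw [h4, mul_comm]⟩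
    exact hm (Int.eq_zero_of_abs_lt_dvd h5 hmM)
  have hgeom : ∑ k ∈ Finset.range M, ζ ^ k = 0 := by
    rw [geom_sum_eq hne, hpow, sub_self, zero_div]
  have hterm : ∀ k ∈ Finset.range M, Real.cos (m * (θ - 2 * Real.pi * k / M)) =
      (Complex.exp (((m * θ : ℝ) : ℂ) * Complex.I) * ζ ^ k).re := by
    intro k _
    rw [hζ, ← Complex.exp_nat_mul, ← Complex.exp_add, ← Complex.exp_ofReal_mul_I_re]
    congr 2
    push_cast
    ring
  rw [Finset.sum_congr rfl hterm, ← Complex.re_sum, ← Finset.mul_sum, hgeom, mul_zero,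
    Complex.zero_re]

/-- The trigonometric polynomial `|∑ j < M, a j * exp (i j u)|²`. -/
def trigKernel (a : ℕ → ℝ) (M : ℕ) (u : ℝ) : ℝ :=
  ∑ j ∈ Finset.range M, ∑ l ∈ Finset.range M, a j * a l * Real.cos (((j : ℤ) - (l : ℤ) : ℤ) * u)

theorem trigKernel_eq_normSq (a : ℕ → ℝ) (M : ℕ) (u : ℝ) :
    trigKernel a M u = Complex.normSq
      (∑ j ∈ Finset.range M, (a j : ℂ) * Complex.exp (u * Complex.I) ^ j) := by
  have h : ∀ j : ℕ, (a j : ℂ) * Complex.exp (u * Complex.I) ^ j =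
      a j * Complex.exp (((j * u : ℝ) : ℂ) * Complex.I) := by
    intro j
    rw [← Complex.exp_nat_mul]
    push_cast
    ring_nf
  simp only [h, Complex.normSq_apply, Complex.re_sum, Complex.im_sum, Complex.re_ofReal_mul,
    Complex.im_ofReal_mul, Complex.exp_ofReal_mul_I_re, Complex.exp_ofReal_mul_I_im,
    Finset.sum_mul_sum, ← Finset.sum_add_distrib, trigKernel]
  refine Finset.sum_congr rfl fun j _ => Finset.sum_congr rfl fun l _ => ?_
  push_cast
  rw [sub_mul, Real.cos_sub]
  ring

theorem trigKernel_nonneg (a : ℕ → ℝ) (M : ℕ) (u : ℝ) : 0 ≤ trigKernel a M u := by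
  rw [trigKernel_eq_normSq]
  exact Complex.normSq_nonneg _

/-- Discrete Parseval: all frequencies `j - l` are smaller than `M` in absolute value, so `M`
equally spaced nodes see no aliasing and only the diagonal survives. -/
theorem sum_trigKernel (a : ℕ → ℝ) (M : ℕ) (θ : ℝ) :
    ∑ k ∈ Finset.range M, trigKernel a M (θ - 2 * Real.pi * k / M) =
      M * ∑ j ∈ Finset.range M, a j ^ 2 := by
  simp only [trigKernel]
  rw [Finset.sum_comm, Finset.mul_sum]
  refine Finset.sum_congr rfl fun j hj => ?_
  rw [Finset.sum_comm]
  simp only [← Finset.mul_sum]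
  rw [Finset.sum_eq_single j]
  · simp
    ring
  · intro l hl hlj
    rw [Finset.mem_range] at hj hl
    rw [sum_range_cos_eq_zero, mul_zero]
    · omega
    · rw [abs_lt]
      omega
  · exact fun h => absurd hj h

/-- Multiplication by `|1 - exp (i u)|²` is summation by parts on the coefficients. -/
theorem trigKernel_mul_two_sub_two_cos {a : ℕ → ℝ} {M : ℕ} (h0 : a 0 = 0) (hM : a M = 0)
    (u : ℝ) :
    trigKernel a M u * (2 - 2 * Real.cos u) = trigKernel (fun j => a (j + 1) - a j) M u := by
  set z : ℂ := Complex.exp (u * Complex.I) with hz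
  have hz1 : Complex.normSq z = 1 := by
    rw [Complex.normSq_eq_norm_sq, hz, Complex.norm_exp_ofReal_mul_I, one_pow]
  have hcos : (2 - 2 * Real.cos u) = Complex.normSq (1 - z) := by
    rw [Complex.normSq_apply, Complex.sub_re, Complex.sub_im, hz, Complex.exp_ofReal_mul_I_re,
      Complex.exp_ofReal_mul_I_im, Complex.one_re, Complex.one_im]
    linear_combination -(Real.sin_sq_add_cos_sq u)
  rw [hcos, trigKernel_eq_normSq, trigKernel_eq_normSq, ← hz, ← Complex.normSq_mul]
  -- A factor `|z|² = 1` raises the power to `z^(j+1)`, which matches the shifted sum `hshift`.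
  rw [← mul_one (Complex.normSq (∑ j ∈ Finset.range M, ((a (j + 1) - a j : ℝ) : ℂ) * z ^ j)),
    ← hz1, ← Complex.normSq_mul]
  congr 1
  have hshift : ∑ j ∈ Finset.range M, (a (j + 1) : ℂ) * z ^ (j + 1) =
      ∑ j ∈ Finset.range M, (a j : ℂ) * z ^ j := by
    have h1 := Finset.sum_range_succ' (fun j => (a j : ℂ) * z ^ j) M
    have h2 := Finset.sum_range_succ (fun j => (a j : ℂ) * z ^ j) M
    simp only [h0, hM, Complex.ofReal_zero, zero_mul, add_zero] at h1 h2
    exact h1.symm.trans h2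
  rw [mul_sub, mul_one]
  nth_rewrite 1 [← hshift]
  rw [Finset.sum_mul, Finset.sum_mul, ← Finset.sum_sub_distrib]
  refine Finset.sum_congr rfl fun j _ => ?_
  push_cast
  ring

theorem sum_range_sin_sq {M : ℕ} (hM : 2 ≤ M) :
    ∑ j ∈ Finset.range M, Real.sin (Real.pi * j / M) ^ 2 = M / 2 := by
  have h := sum_range_cos_eq_zero (M := M) (m := 1) one_ne_zero
    (by rw [abs_one]; exact_mod_cast hM) 0
  have h2 : ∀ j ∈ Finset.range M, Real.sin (Real.pi * j / M) ^ 2 =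
      1 / 2 - Real.cos ((1 : ℤ) * (0 - 2 * Real.pi * j / M)) / 2 := by
    intro j _
    rw [Real.sin_sq_eq_half_sub]
    congr 2
    rw [Int.cast_one, one_mul, zero_sub, Real.cos_neg]
    congr 1
    ring
  rw [Finset.sum_congr rfl h2, Finset.sum_sub_distrib, ← Finset.sum_div, ← Finset.sum_div, h]
  simp

theorem sum_range_sin_sub_sin_sq_le {M : ℕ} (hM : 0 < M) :
    ∑ j ∈ Finset.range M,
      (Real.sin (Real.pi * (j + 1 : ℕ) / M) - Real.sin (Real.pi * j / M)) ^ 2 ≤ 10 / M := by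
  have hM' : (0 : ℝ) < M := by exact_mod_cast hM
  have hterm : ∀ j ∈ Finset.range M,
      (Real.sin (Real.pi * (j + 1 : ℕ) / M) - Real.sin (Real.pi * j / M)) ^ 2 ≤
        10 / (M : ℝ) ^ 2 := by
    intro j _
    have h1 : |Real.sin (Real.pi * (j + 1 : ℕ) / M) - Real.sin (Real.pi * j / M)| ≤
        Real.pi / M := by
      have h := Real.lipschitzWith_sin.dist_le_mul (Real.pi * (j + 1 : ℕ) / M) (Real.pi * j / M)
      rw [Real.dist_eq, Real.dist_eq, NNReal.coe_one, one_mul] at h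
      refine h.trans (le_of_eq ?_)
      rw [show Real.pi * (j + 1 : ℕ) / M - Real.pi * j / M = Real.pi / M by push_cast; ring,
        abs_of_pos (div_pos Real.pi_pos hM')]
    have hpi : Real.pi ^ 2 ≤ 10 := by nlinarith [Real.pi_lt_d2, Real.pi_pos]
    calc _ ≤ (Real.pi / M) ^ 2 := sq_le_sq' (neg_le_of_abs_le h1) (le_of_abs_le h1)
      _ = Real.pi ^ 2 / (M : ℝ) ^ 2 := div_pow _ _ _
      _ ≤ _ := by gcongr
  refine (Finset.sum_le_sum hterm).trans (le_of_eq ?_)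
  rw [Finset.sum_const, Finset.card_range, nsmul_eq_mul]
  field_simp

/-- The algebraic polynomial which at `cos φ` is the even part of `φ ↦ trigKernel a M (φ - θ)`. -/
def kernelPolynomial (a : ℕ → ℝ) (M : ℕ) (θ : ℝ) : Polynomial ℝ :=
  ∑ j ∈ Finset.range M, ∑ l ∈ Finset.range M,
    Polynomial.C (a j * a l * Real.cos (((j : ℤ) - (l : ℤ) : ℤ) * θ)) *
      Polynomial.Chebyshev.T ℝ ((j : ℤ) - l)

/-- As `a 0 = 0`, only indices from `1` to `n + 1` count, and these differ by at most `n`; so `n +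
2` coefficients cost only degree `n`. -/
theorem natDegree_kernelPolynomial_le {a : ℕ → ℝ} (h0 : a 0 = 0) (n : ℕ) (θ : ℝ) :
    (kernelPolynomial a (n + 2) θ).natDegree ≤ n := by
  refine Polynomial.natDegree_sum_le_of_forall_le _ _ fun j hj =>
    Polynomial.natDegree_sum_le_of_forall_le _ _ fun l hl => ?_
  rw [Finset.mem_range] at hj hl
  rcases Nat.eq_zero_or_pos j with rfl | hj0
  · simp [h0]
  rcases Nat.eq_zero_or_pos l with rfl | hl0
  · simp [h0]
  refine (Polynomial.natDegree_C_mul_le _ _).trans ?_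
  rw [Polynomial.Chebyshev.natDegree_T]
  omega

theorem eval_kernelPolynomial_cos (a : ℕ → ℝ) (M : ℕ) (θ φ : ℝ) :
    (kernelPolynomial a M θ).eval (Real.cos φ) =
      (trigKernel a M (φ - θ) + trigKernel a M (-φ - θ)) / 2 := by
  simp only [kernelPolynomial, trigKernel, Polynomial.eval_finsetSum, Polynomial.eval_mul,
    Polynomial.eval_C, Polynomial.Chebyshev.T_real_cos, ← Finset.sum_add_distrib, Finset.sum_div]
  refine Finset.sum_congr rfl fun j _ => Finset.sum_congr rfl fun l _ => ?_
  rw [mul_sub, mul_sub, Real.cos_sub, Real.cos_sub, mul_neg, Real.cos_neg, Real.sin_neg]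
  ring

/-- The right side is `|exp(iφ) - exp(iθ)|²`, the left side its real-part contribution. -/
theorem sq_cos_sub_cos_le (θ φ : ℝ) :
    (Real.cos θ - Real.cos φ) ^ 2 ≤ 2 - 2 * Real.cos (φ - θ) := by
  rw [Real.cos_sub]
  nlinarith [sq_nonneg (Real.sin θ - Real.sin φ), Real.sin_sq_add_cos_sq θ,
    Real.sin_sq_add_cos_sq φ]

/-- Positive polynomials of degree `n` which form a partition of unity on `[0, 1]` and are
concentrated, in mean square, at distance `O(1 / n)` from the nodes `t k`. -/
theorem exists_jackson_partition (n : ℕ) :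
    ∃ (q : Fin (n + 2) → Polynomial ℝ) (t : Fin (n + 2) → ℝ),
      (∀ k, (q k).natDegree ≤ n) ∧
      ∀ x ∈ Set.Icc (0 : ℝ) 1, (∀ k, 0 ≤ (q k).eval (2 * x - 1)) ∧
        ∑ k, (q k).eval (2 * x - 1) = 1 ∧
        ∑ k, (q k).eval (2 * x - 1) * (t k - x) ^ 2 ≤ 5 / ((n : ℝ) + 2) ^ 2 := by
  set M : ℕ := n + 2 with hMdef
  have hM : (0 : ℝ) < M := by positivity
  have hMn : (M : ℝ) = n + 2 := by simp [hMdef]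
  set a : ℕ → ℝ := fun j => Real.sin (Real.pi * j / M) with ha
  have ha0 : a 0 = 0 := by simp [ha]
  have haM : a M = 0 := by simp [ha, mul_div_assoc]
  have hS : ∑ j ∈ Finset.range M, a j ^ 2 = M / 2 := sum_range_sin_sq (by omega)
  -- The kernel has total mass `M · M/2` over the nodes; `c` normalises it to `1`.
  set c : ℝ := 2 / (M : ℝ) ^ 2 with hc
  have hc0 : 0 ≤ c := by positivity
  set θ : ℕ → ℝ := fun k => 2 * Real.pi * k / M with hθ
  refine ⟨fun k => Polynomial.C c * kernelPolynomial a M (θ k),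
    fun k => (1 + Real.cos (θ k)) / 2, fun k => ?_, fun x hx => ?_⟩
  · exact (Polynomial.natDegree_C_mul_le _ _).trans (natDegree_kernelPolynomial_le ha0 n _)
  set φ : ℝ := Real.arccos (2 * x - 1) with hφ
  have hcos : 2 * x - 1 = Real.cos φ :=
    (Real.cos_arccos (by linarith [hx.1]) (by linarith [hx.2])).symm
  have heval : ∀ k : ℕ, (Polynomial.C c * kernelPolynomial a M (θ k)).eval (2 * x - 1) =
      c * ((trigKernel a M (φ - θ k) + trigKernel a M (-φ - θ k)) / 2) := by
    intro k
    rw [Polynomial.eval_mul, Polynomial.eval_C, hcos, eval_kernelPolynomial_cos]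
  simp only [heval]
  refine ⟨fun k => mul_nonneg hc0 (by
    linarith [trigKernel_nonneg a M (φ - θ k), trigKernel_nonneg a M (-φ - θ k)]), ?_, ?_⟩
  · rw [Fin.sum_univ_eq_sum_range
      (fun k => c * ((trigKernel a M (φ - θ k) + trigKernel a M (-φ - θ k)) / 2)),
      ← Finset.mul_sum, ← Finset.sum_div, Finset.sum_add_distrib, sum_trigKernel,
      sum_trigKernel, hS, hc]
    field_simp
    norm_num
  · have hD : ∑ j ∈ Finset.range M, (a (j + 1) - a j) ^ 2 ≤ 10 / M :=
      sum_range_sin_sub_sin_sq_le (by omega)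
    have hx' : x = (1 + Real.cos φ) / 2 := by linarith
    rw [Fin.sum_univ_eq_sum_range (fun k => c * ((trigKernel a M (φ - θ k) +
      trigKernel a M (-φ - θ k)) / 2) * ((1 + Real.cos (θ k)) / 2 - x) ^ 2)]
    -- The `1/8` is `1/4` from `(t_k - x)² = (cos θ_k - cos φ)² / 4` times `1/2` from the even part.
    -- The angles `φ` and `-φ` have the same cosine, so the chord bound applies to both halves, and
    -- summation by parts absorbs the chord factor.
    have hterm : ∀ k ∈ Finset.range M, c * ((trigKernel a M (φ - θ k) +
        trigKernel a M (-φ - θ k)) / 2) * ((1 + Real.cos (θ k)) / 2 - x) ^ 2 ≤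
        c / 8 * (trigKernel (fun j => a (j + 1) - a j) M (φ - θ k) +
          trigKernel (fun j => a (j + 1) - a j) M (-φ - θ k)) := by
      intro k _
      rw [← trigKernel_mul_two_sub_two_cos ha0 haM, ← trigKernel_mul_two_sub_two_cos ha0 haM]
      have h1 := mul_le_mul_of_nonneg_left (sq_cos_sub_cos_le (θ k) φ)
        (trigKernel_nonneg a M (φ - θ k))
      have h2 := mul_le_mul_of_nonneg_left (sq_cos_sub_cos_le (θ k) (-φ))
        (trigKernel_nonneg a M (-φ - θ k))
      rw [Real.cos_neg] at h2
      have h3 := mul_le_mul_of_nonneg_left (add_le_add h1 h2) (by positivity : 0 ≤ c / 8)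
      refine le_trans (le_of_eq ?_) h3
      rw [hx']
      ring
    refine (Finset.sum_le_sum hterm).trans ?_
    rw [← Finset.mul_sum, Finset.sum_add_distrib, sum_trigKernel, sum_trigKernel, ← hMn]
    calc c / 8 * (M * ∑ j ∈ Finset.range M, (a (j + 1) - a j) ^ 2 +
          M * ∑ j ∈ Finset.range M, (a (j + 1) - a j) ^ 2)
        ≤ c / 8 * (M * (10 / M) + M * (10 / M)) := by gcongr
      _ = 5 / (M : ℝ) ^ 2 := by
        rw [hc]
        field_simp
        norm_num

/-! ### Approximation in several variables -/

/-- The marginal of a product of normalised weights: all factors but the one at `i₀` sum to `1`. -/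
theorem sum_prod_mul_eq_sum {ι κ : Type*} [Fintype ι] [DecidableEq ι] [Fintype κ]
    {Q : ι → κ → ℝ} (hQ : ∀ i, ∑ k, Q i k = 1) (i₀ : ι) (h : κ → ℝ) :
    ∑ k : ι → κ, (∏ i, Q i (k i)) * h (k i₀) = ∑ k, Q i₀ k * h k := by
  have h1 : ∀ k : ι → κ, (∏ i, Q i (k i)) * h (k i₀) =
      ∏ i, Q i (k i) * (if i = i₀ then h (k i) else 1) := by
    intro k
    rw [Finset.prod_mul_distrib, Finset.prod_ite_eq' Finset.univ i₀ fun i => h (k i),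
      if_pos (Finset.mem_univ _)]
  simp only [h1]
  rw [← Fintype.prod_sum fun i k => Q i k * (if i = i₀ then h k else 1),
    Finset.prod_eq_single i₀]
  · simp
  · intro i _ hi
    simp [hi, hQ i]
  · exact fun hi => absurd (Finset.mem_univ _) hi

theorem exists_isParallelOutput_abs_sub_le {d : ℕ} [NeZero d] (N : ℕ)
    {X : Set (EuclideanSpace ℝ (Fin d))} {g : EuclideanSpace ℝ (Fin d) → ℝ} {a b : ℝ}
    (hX : IsCompact X) (hXc : X ⊆ unitCube d) (hb : 0 ≤ b)
    (h : ∀ x ∈ X, ∀ y ∈ X, |g x - g y| ≤ a + b * ‖x - y‖) :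
    ∃ f : EuclideanSpace ℝ (Fin d) → ℝ, IsParallelOutput N f ∧
      ∀ x ∈ X, |g x - f x| ≤ a + 6 * b * (Real.sqrt d / ((N / d : ℕ) + 2)) := by
  rcases X.eq_empty_or_nonempty with rfl | hne
  · exact ⟨_, IsParallelOutput.sum (κ := Empty) ∅ (fun _ => 0) (F := fun _ _ => 0) nofun,
      by simp⟩
  set n := N / d with hn
  obtain ⟨q, t, hdeg, hq⟩ := exists_jackson_partition n
  -- The grid points `τ k` may lie outside `X`, so `g` is sampled at nearest points of `X`; as `x ∈
  -- X`, this at most doubles the distance to `x`.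
  choose p hpX hp using fun z : EuclideanSpace ℝ (Fin d) => hX.exists_infDist_eq_dist hne z
  set τ : (Fin d → Fin (n + 2)) → EuclideanSpace ℝ (Fin d) :=
    fun k => WithLp.toLp 2 fun i => t (k i) with hτ
  refine ⟨fun x => ∑ k : Fin d → Fin (n + 2), g (p (τ k)) *
    ∏ i, (q (k i)).eval (2 * x i - 1), IsParallelOutput.sum _ _ fun k =>
      isParallelOutput_prod (fun i => q (k i)) fun i => hdeg _, fun x hx => ?_⟩
  set W : (Fin d → Fin (n + 2)) → ℝ := fun k => ∏ i, (q (k i)).eval (2 * x i - 1) with hW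
  have hQ : ∀ i, ∑ k, (q k).eval (2 * x i - 1) = 1 := fun i => (hq _ (hXc hx i)).2.1
  have hW0 : ∀ k, 0 ≤ W k := fun k =>
    Finset.prod_nonneg fun i _ => (hq _ (hXc hx i)).1 (k i)
  have hW1 : ∑ k, W k = 1 := by
    rw [hW, ← Fintype.prod_sum fun i k => (q k).eval (2 * x i - 1)]
    simp [hQ]
  set ρ : ℝ := Real.sqrt d / ((n : ℝ) + 2) with hρ
  have hd : (0 : ℝ) < d := by exact_mod_cast NeZero.pos d
  have hρ0 : 0 < ρ := div_pos (Real.sqrt_pos.2 hd) (by positivity)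
  have hmoment : ∑ k, W k * ‖τ k - x‖ ^ 2 ≤ 5 * ρ ^ 2 := by
    have h1 : ∀ k, W k * ‖τ k - x‖ ^ 2 = ∑ i, W k * (t (k i) - x i) ^ 2 := by
      intro k
      rw [EuclideanSpace.real_norm_sq_eq, Finset.mul_sum]
      rfl
    simp only [h1]
    rw [Finset.sum_comm]
    calc ∑ i, ∑ k, W k * (t (k i) - x i) ^ 2
        = ∑ i, ∑ k, (q k).eval (2 * x i - 1) * (t k - x i) ^ 2 :=
          Finset.sum_congr rfl fun i _ => sum_prod_mul_eq_sum hQ i fun k => (t k - x i) ^ 2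
      _ ≤ ∑ _i : Fin d, 5 / ((n : ℝ) + 2) ^ 2 :=
          Finset.sum_le_sum fun i _ => (hq _ (hXc hx i)).2.2
      _ = 5 * ρ ^ 2 := by
          rw [Finset.sum_const, Finset.card_univ, Fintype.card_fin, nsmul_eq_mul, hρ, div_pow,
            Real.sq_sqrt hd.le]
          ring
  have hpoint : ∀ k, |g x - g (p (τ k))| ≤ a + b * (‖τ k - x‖ ^ 2 / ρ + ρ) := by
    intro k
    refine (h x hx _ (hpX _)).trans ?_
    gcongr
    have h1 : dist (τ k) (p (τ k)) ≤ dist (τ k) x := by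
      rw [← hp]
      exact Metric.infDist_le_dist_of_mem hx
    have h2 : ‖x - p (τ k)‖ ≤ 2 * ‖τ k - x‖ := by
      have h3 := dist_triangle x (τ k) (p (τ k))
      rw [dist_comm x (τ k)] at h3
      rw [← dist_eq_norm, ← dist_eq_norm]
      linarith
    refine h2.trans ?_
    -- AM–GM, `2 r ≤ r² / ρ + ρ`, replaces the distance by its square, whose mean is controlled by
    -- `hmoment`.
    rw [div_add' _ _ _ hρ0.ne', le_div_iff₀ hρ0]
    nlinarith [sq_nonneg (‖τ k - x‖ - ρ)]
  have hdiff : g x - ∑ k, g (p (τ k)) * W k = ∑ k, W k * (g x - g (p (τ k))) := by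
    simp only [mul_sub, Finset.sum_sub_distrib]
    rw [← Finset.sum_mul, hW1, one_mul]
    simp only [mul_comm]
  calc |g x - ∑ k, g (p (τ k)) * W k| ≤ ∑ k, W k * |g x - g (p (τ k))| := by
        rw [hdiff]
        refine (Finset.abs_sum_le_sum_abs _ _).trans (le_of_eq ?_)
        simp only [abs_mul, abs_of_nonneg (hW0 _)]
    _ ≤ ∑ k, W k * (a + b * (‖τ k - x‖ ^ 2 / ρ + ρ)) :=
        Finset.sum_le_sum fun k _ => mul_le_mul_of_nonneg_left (hpoint k) (hW0 k)
    _ = (a + b * ρ) * ∑ k, W k + b / ρ * ∑ k, W k * ‖τ k - x‖ ^ 2 := by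
        rw [Finset.mul_sum, Finset.mul_sum, ← Finset.sum_add_distrib]
        exact Finset.sum_congr rfl fun k _ => by ring
    _ ≤ (a + b * ρ) * 1 + b / ρ * (5 * ρ ^ 2) := by
        rw [hW1]
        gcongr
    _ = a + 6 * b * ρ := by
        field_simp
        ring

theorem sqrt_div_le_rpow_div {d N : ℕ} (hd : 0 < d) (hN : 1 ≤ N) :
    Real.sqrt d / ((N / d : ℕ) + 2) ≤ (d : ℝ) ^ (3 / 2 : ℝ) / N := by
  have hd' : (0 : ℝ) < d := by exact_mod_cast hd
  have hN' : (0 : ℝ) < N := by exact_mod_cast hN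
  have hpow : (d : ℝ) ^ (3 / 2 : ℝ) = d * Real.sqrt d := by
    rw [show (3 / 2 : ℝ) = 1 + 1 / 2 by norm_num, Real.rpow_add hd', Real.rpow_one,
      Real.sqrt_eq_rpow]
  have h1 : (N : ℝ) ≤ d * ((N / d : ℕ) + 1) := by
    exact_mod_cast (Nat.lt_mul_div_succ N hd).le
  rw [hpow, div_le_div_iff₀ (by positivity) hN']
  have h2 : (N : ℝ) ≤ d * ((N / d : ℕ) + 2) := by linarith
  calc Real.sqrt d * N ≤ Real.sqrt d * (d * ((N / d : ℕ) + 2)) := by gcongr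
    _ = _ := by ring

/-! ### The modulus of continuity -/

section Modulus

variable {d : ℕ} {X : Set (EuclideanSpace ℝ (Fin d))} {g : EuclideanSpace ℝ (Fin d) → ℝ}

theorem modulus_nonneg (X : Set (EuclideanSpace ℝ (Fin d))) (g : EuclideanSpace ℝ (Fin d) → ℝ)
    (δ : ℝ) : 0 ≤ modulus X g δ :=
  Real.sSup_nonneg (by rintro _ ⟨x, -, y, -, -, rfl⟩; exact abs_nonneg _)

/-- Boundedness of `g` on the compact `X` is needed because the real `sSup` of a set unbounded above
is `0`. -/
theorem abs_sub_le_modulus (hX : IsCompact X) (hg : ContinuousOn g X) {δ : ℝ}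
    {x y : EuclideanSpace ℝ (Fin d)} (hx : x ∈ X) (hy : y ∈ X) (hxy : ‖x - y‖ ≤ δ) :
    |g x - g y| ≤ modulus X g δ := by
  obtain ⟨K, hK⟩ := hX.exists_bound_of_continuousOn hg
  refine le_csSup ⟨K + K, ?_⟩ ⟨x, hx, y, hy, hxy, rfl⟩
  rintro _ ⟨u, hu, v, hv, -, rfl⟩
  exact (abs_sub _ _).trans (add_le_add (hK u hu) (hK v hv))

theorem exists_modulus_le (hX : IsCompact X) (hg : ContinuousOn g X) {η : ℝ} (hη : 0 < η) :
    ∃ δ₀ > 0, ∀ δ < δ₀, modulus X g δ ≤ η := by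
  obtain ⟨δ₀, hδ₀, h⟩ := Metric.uniformContinuousOn_iff.1
    (hX.uniformContinuousOn_of_continuous hg) η hη
  refine ⟨δ₀, hδ₀, fun δ hδ => Real.sSup_le ?_ hη.le⟩
  rintro _ ⟨x, hx, y, hy, hxy, rfl⟩
  rw [← Real.dist_eq]
  exact (h x hx y hy (by rw [dist_eq_norm]; exact hxy.trans_lt hδ)).le

/-- Walk from `x` to `y` in `m` equal steps of length at most `δ`; convexity keeps the intermediate
points in `X`. The induction splits off the first step, a fraction `1/(m+1)` of the segment. -/
theorem abs_sub_le_nat_mul_of_convex (hX : Convex ℝ X) {δ w : ℝ}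
    (h : ∀ x ∈ X, ∀ y ∈ X, ‖x - y‖ ≤ δ → |g x - g y| ≤ w) (m : ℕ) :
    ∀ x ∈ X, ∀ y ∈ X, ‖x - y‖ ≤ m * δ → |g x - g y| ≤ m * w := by
  induction m with
  | zero =>
    intro x _ y _ hxy
    rw [Nat.cast_zero, zero_mul, norm_le_zero_iff, sub_eq_zero] at hxy
    simp [hxy]
  | succ m ih =>
    intro x hx y hy hxy
    have hm : (0 : ℝ) < m + 1 := by positivity
    push_cast at hxy ⊢
    set s : ℝ := 1 / (m + 1) with hs
    have hs0 : 0 ≤ s := by positivity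
    have hs1 : 1 - s = m / (m + 1) := by rw [hs]; field_simp; ring
    have hs2 : 0 ≤ 1 - s := by rw [hs1]; positivity
    have hz : (1 - s) • x + s • y ∈ X := hX hx hy hs2 hs0 (by ring)
    have h1 : ‖x - ((1 - s) • x + s • y)‖ ≤ δ := by
      rw [show x - ((1 - s) • x + s • y) = s • (x - y) by module, norm_smul,
        Real.norm_of_nonneg hs0]
      calc s * ‖x - y‖ ≤ s * ((m + 1) * δ) := by gcongr
        _ = δ := by rw [hs]; field_simp
    have h2 : ‖((1 - s) • x + s • y) - y‖ ≤ m * δ := by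
      rw [show ((1 - s) • x + s • y) - y = (1 - s) • (x - y) by module, norm_smul,
        Real.norm_of_nonneg hs2]
      calc (1 - s) * ‖x - y‖ ≤ (1 - s) * ((m + 1) * δ) := by gcongr
        _ = m * δ := by rw [hs1]; field_simp
    linarith [abs_sub_le (g x) (g ((1 - s) • x + s • y)) (g y), h _ hx _ hz h1, ih _ hz _ hy h2]

theorem abs_sub_le_modulus_mul (hX : IsCompact X) (hconv : Convex ℝ X) (hg : ContinuousOn g X)
    {δ : ℝ} (hδ : 0 < δ) {x y : EuclideanSpace ℝ (Fin d)} (hx : x ∈ X) (hy : y ∈ X) :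
    |g x - g y| ≤ modulus X g δ + modulus X g δ / δ * ‖x - y‖ := by
  have h := abs_sub_le_nat_mul_of_convex hconv
    (fun u hu v hv huv => abs_sub_le_modulus hX hg hu hv huv) ⌈‖x - y‖ / δ⌉₊ x hx y hy
    ((div_le_iff₀ hδ).1 (Nat.le_ceil _))
  have hceil : (⌈‖x - y‖ / δ⌉₊ : ℝ) ≤ ‖x - y‖ / δ + 1 :=
    (Nat.ceil_lt_add_one (by positivity)).le
  calc |g x - g y| ≤ (‖x - y‖ / δ + 1) * modulus X g δ :=
        h.trans (mul_le_mul_of_nonneg_right hceil (modulus_nonneg _ _ _))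
    _ = _ := by ring

theorem modulus_pos (hX : IsCompact X) (hconv : Convex ℝ X) (hg : ContinuousOn g X)
    (hne : ∃ x ∈ X, ∃ y ∈ X, g x ≠ g y) {δ : ℝ} (hδ : 0 < δ) : 0 < modulus X g δ := by
  obtain ⟨x, hx, y, hy, hxy⟩ := hne
  refine (modulus_nonneg X g δ).lt_of_ne fun h => hxy ?_
  have := abs_sub_le_modulus_mul hX hconv hg hδ hx hy
  rw [← h, zero_div, zero_mul, add_zero] at this
  exact sub_eq_zero.1 (abs_nonpos_iff.1 this)

end Modulus

/-! ### The two error bounds and the main theorem -/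

theorem exists_isParallelOutput_modulus {d : ℕ} [NeZero d]
    {X : Set (EuclideanSpace ℝ (Fin d))} {g : EuclideanSpace ℝ (Fin d) → ℝ}
    (hX : IsCompact X) (hXc : X ⊆ unitCube d) (hg : ContinuousOn g X) (hconv : Convex ℝ X)
    {N : ℕ} (hN : 1 ≤ N) :
    ∃ f : EuclideanSpace ℝ (Fin d) → ℝ, IsParallelOutput N f ∧
      ∀ x ∈ X, |g x - f x| ≤ 7 * modulus X g ((d : ℝ) ^ (3 / 2 : ℝ) / (N : ℝ)) := by
  have hd : 0 < d := NeZero.pos d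
  set δ : ℝ := (d : ℝ) ^ (3 / 2 : ℝ) / (N : ℝ) with hδ
  have hδ0 : 0 < δ := by positivity
  have hω := modulus_nonneg X g δ
  obtain ⟨f, hf, hfg⟩ := exists_isParallelOutput_abs_sub_le N hX hXc (by positivity)
    fun x hx y hy => abs_sub_le_modulus_mul hX hconv hg hδ0 hx hy
  refine ⟨f, hf, fun x hx => (hfg x hx).trans ?_⟩
  calc modulus X g δ + 6 * (modulus X g δ / δ) * (Real.sqrt d / ((N / d : ℕ) + 2))
      ≤ modulus X g δ + 6 * (modulus X g δ / δ) * δ := by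
        gcongr
        exact sqrt_div_le_rpow_div hd hN
    _ = 7 * modulus X g δ := by
        field_simp
        ring

theorem exists_isParallelOutput_lipschitz {d : ℕ} [NeZero d]
    {X : Set (EuclideanSpace ℝ (Fin d))} {g : EuclideanSpace ℝ (Fin d) → ℝ} {C : NNReal}
    (hX : IsCompact X) (hXc : X ⊆ unitCube d) (hg : LipschitzOnWith C g X)
    {N : ℕ} (hN : 1 ≤ N) :
    ∃ f : EuclideanSpace ℝ (Fin d) → ℝ, IsParallelOutput N f ∧
      ∀ x ∈ X, |g x - f x| ≤ 6 * (C : ℝ) * ((d : ℝ) ^ (3 / 2 : ℝ) / (N : ℝ)) := by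
  obtain ⟨f, hf, hfg⟩ := exists_isParallelOutput_abs_sub_le (a := 0) (b := C) N hX hXc C.2
    fun x hx y hy => by
      rw [zero_add, ← Real.dist_eq, ← dist_eq_norm]
      exact hg.dist_le_mul x hx y hy
  refine ⟨f, hf, fun x hx => (hfg x hx).trans ?_⟩
  rw [zero_add]
  exact mul_le_mul_of_nonneg_left (sqrt_div_le_rpow_div (NeZero.pos d) hN) (by positivity)

end QuantumFeature

end

theorem mainTheorem4 :
    ∃ A : ℝ, 0 < A ∧
      ∀ (d : ℕ) [NeZero d] (X : Set (EuclideanSpace ℝ (Fin d)))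
        (g : EuclideanSpace ℝ (Fin d) → ℝ),
        IsCompact X → X ⊆ QuantumFeature.unitCube d → ContinuousOn g X →
        (Convex ℝ X →
          (∀ N : ℕ, 1 ≤ N → ∃ f : EuclideanSpace ℝ (Fin d) → ℝ,
            QuantumFeature.IsParallelOutput N f ∧
            (∀ x ∈ X, |g x - f x| ≤
              A * QuantumFeature.modulus X g ((d : ℝ) ^ (3 / 2 : ℝ) / (N : ℝ))) ∧
            ((∃ x ∈ X, ∃ y ∈ X, g x ≠ g y) → ∀ x ∈ X, |g x - f x| <
              A * QuantumFeature.modulus X g ((d : ℝ) ^ (3 / 2 : ℝ) / (N : ℝ)))) ∧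
          (∀ ε : ℝ, 0 < ε →
            (∀ᶠ N : ℕ in Filter.atTop,
              A * QuantumFeature.modulus X g ((d : ℝ) ^ (3 / 2 : ℝ) / (N : ℝ)) < ε) ∧
            (∀ N : ℕ, 1 ≤ N →
              A * QuantumFeature.modulus X g ((d : ℝ) ^ (3 / 2 : ℝ) / (N : ℝ)) < ε →
              ∃ f : EuclideanSpace ℝ (Fin d) → ℝ,
                QuantumFeature.IsParallelOutput N f ∧ ∀ x ∈ X, |g x - f x| < ε))) ∧
        (∀ C : NNReal, LipschitzOnWith C g X →
          (∀ N : ℕ, 1 ≤ N → ∃ f : EuclideanSpace ℝ (Fin d) → ℝ,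
            QuantumFeature.IsParallelOutput N f ∧
            ∀ x ∈ X, |g x - f x| ≤ A * (C : ℝ) * (d : ℝ) ^ (3 / 2 : ℝ) / (N : ℝ)) ∧
          (∀ ε : ℝ, 0 < ε → ∀ N : ℕ, A * (C : ℝ) * (d : ℝ) ^ (3 / 2 : ℝ) * ε⁻¹ < (N : ℝ) →
            ∃ f : EuclideanSpace ℝ (Fin d) → ℝ,
              QuantumFeature.IsParallelOutput N f ∧ ∀ x ∈ X, |g x - f x| < ε)) := by
  -- The bounds proved have constants `7` (modulus) and `6` (Lipschitz). The slack up to `8` gives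
  -- the strict inequality when `g` is not constant, since then `ω > 0`.
  refine ⟨8, by norm_num, fun d _ X g hX hXc hg => ⟨fun hconv => ⟨fun N hN => ?_, fun ε hε =>
    ⟨?_, fun N hN hlt => ?_⟩⟩, fun C hC => ?_⟩⟩
  · obtain ⟨f, hf, hfg⟩ := QuantumFeature.exists_isParallelOutput_modulus hX hXc hg hconv hN
    have hω := QuantumFeature.modulus_nonneg X g ((d : ℝ) ^ (3 / 2 : ℝ) / (N : ℝ))
    refine ⟨f, hf, fun x hx => (hfg x hx).trans (by linarith), fun hne x hx => ?_⟩
    have hd : 0 < d := NeZero.pos d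
    have := QuantumFeature.modulus_pos hX hconv hg hne
      (δ := (d : ℝ) ^ (3 / 2 : ℝ) / (N : ℝ)) (by positivity)
    linarith [hfg x hx]
  -- With `ω ≤ ε/16`, the bound `8 ω` is at most `ε/2 < ε`.
  · obtain ⟨δ₀, hδ₀, h⟩ := QuantumFeature.exists_modulus_le hX hg
      (show 0 < ε / 16 by positivity)
    filter_upwards [(tendsto_const_div_atTop_nhds_zero_nat
      ((d : ℝ) ^ (3 / 2 : ℝ))).eventually (gt_mem_nhds hδ₀)] with N hN
    linarith [h _ hN]
  · obtain ⟨f, hf, hfg⟩ := QuantumFeature.exists_isParallelOutput_modulus hX hXc hg hconv hN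
    have hω := QuantumFeature.modulus_nonneg X g ((d : ℝ) ^ (3 / 2 : ℝ) / (N : ℝ))
    exact ⟨f, hf, fun x hx => by linarith [hfg x hx]⟩
  · have key : ∀ N : ℕ, 1 ≤ N → ∃ f : EuclideanSpace ℝ (Fin d) → ℝ,
        QuantumFeature.IsParallelOutput N f ∧
        ∀ x ∈ X, |g x - f x| ≤ 8 * (C : ℝ) * (d : ℝ) ^ (3 / 2 : ℝ) / (N : ℝ) := by
      intro N hN
      obtain ⟨f, hf, hfg⟩ := QuantumFeature.exists_isParallelOutput_lipschitz hX hXc hC hN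
      refine ⟨f, hf, fun x hx => (hfg x hx).trans ?_⟩
      rw [← mul_div_assoc]
      gcongr
      norm_num
    refine ⟨key, fun ε hε N hlt => ?_⟩
    have hN : (0 : ℝ) < N := lt_of_le_of_lt (by positivity) hlt
    obtain ⟨f, hf, hfg⟩ := key N (by exact_mod_cast hN)
    refine ⟨f, hf, fun x hx => (hfg x hx).trans_lt ?_⟩
    rw [← div_eq_mul_inv, div_lt_iff₀ hε] at hlt
    rw [div_lt_iff₀ hN]
    linarith
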